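/- Let $d\ge 0$, let $\mathcal X\subset\mathbb R^d$ be open, convex and bounded, and let $L\in\mathbb R$. There is a constant $c_1>0$, depending only on $\mathcal X$ and $L$, such that the following holds. Let $H$ be a map that is differentiable on $\mathcal X$ and a bijection of $\mathcal X$ onto a set $\mathcal Y\subset\mathbb R^d$, and let $\alpha,\beta>0$ be constants with (i) $\|(H'(x)-H'(y))z\|\le\alpha\,\|x-y\|\,\|z\|$ for all $x,y,z\in\mathcal X$; (ii) $\|H^{-1}(u)-H^{-1}(v)\|\le\beta\,\|u-v\|$ for all $u,v\in\mathcal Y$; (iii) $\det H'(x)>0$ for some $x\in\mathcal X$; and suppose that $\|H'(x)\|\le L$ for at least one $x\in\mathcal X$ (for a given $H$ this holds with a suitable $L$). Let $K\ge 1$, and let $R^{(0)},\dots,R^{(K-1)}:\mathbb R^d\to\mathbb R^d$ be any residual terms. Then there are maps $F^{(0)},\dots,F^{(K-1)}:\mathbb R^d\to\mathbb R^d$ such that the $K$-layer GResNet $$x^{(0)}=x,\qquad x^{(k)}=F^{(k-1)}(x^{(k-1)})+R^{(k-1)}(x^{(k-1)})\quad(1\le k\le K)$$ models $H$, that is, $x^{(K)}=H(x)$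 for every $x\in\mathcal X$; the layer $F^{(k-1)}+R^{(k-1)}$ is differentiable at $x^{(k-1)}$ for every $x\in\mathcal X$ and $1\le k\le K$; and, for some $\delta$ with $$0\le\delta\le c\,\frac{\log(2K)}{K},\qquad c=c_1\max\{\alpha\beta(1+\beta),\ \beta(2+\alpha)+\alpha\},$$ the following is true for every $x\in\mathcal X$ and every loss function $\ell:\mathbb R^d\to\mathbb R$ of the network output that is differentiable at $H(x)$. For $0\le k\le K$ the loss, as a function of the $k$-th representation (through the layers $k+1,\dots,K$), is differentiable at $x^{(k)}$, and for $1\le k\le K$ $$(1-\delta)\left\|\frac{\partial\ell}{\partial x^{(k)}}\right\|_2\le\left\|\frac{\partial\ell}{\partial x^{(k-1)}}\right\|_2\le(1+\delta)\left\|\frac{\partial\ell}{\partial x^{(k)}}\right\|_2 .$$ -/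

import Mathlib

/-- The space of (stacked) node representations, `ℝ^d` with the Euclidean norm. -/
abbrev RepSpace (d : ℕ) : Type := EuclideanSpace ℝ (Fin d)

/-- The standing assumption on the target map `H : 𝒳 → 𝒴` with constants `α`, `β`:
`H` is differentiable and invertible, has a Lipschitz derivative and a Lipschitz inverse, and its
Jacobian determinant is positive at some point. -/
structure TargetAssumption {d : ℕ} (𝒳 𝒴 : Set (RepSpace d)) (H : RepSpace d → RepSpace d) (α β : ℝ) : Prop where
  alpha_pos : 0 < α
  beta_pos : 0 < β
  differentiable : ∀ x ∈ 𝒳, DifferentiableAt ℝ H x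
  invertible : Set.BijOn H 𝒳 𝒴
  smooth : ∀ x ∈ 𝒳, ∀ y ∈ 𝒳, ∀ z ∈ 𝒳,
    ‖(fderiv ℝ H x - fderiv ℝ H y) z‖ ≤ α * ‖x - y‖ * ‖z‖
  lipschitz_inverse : ∀ u ∈ 𝒴, ∀ v ∈ 𝒴,
    ‖Function.invFunOn H 𝒳 u - Function.invFunOn H 𝒳 v‖ ≤ β * ‖u - v‖
  positive_det : ∃ x ∈ 𝒳, 0 < (fderiv ℝ H x).det

namespace GResNet

variable {d : ℕ}

/-- The layer with index `k` (counted from `0`), `x ↦ F k x + R k x`, where `F k` is the function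
approximation and `R k` the residual term. -/
def layer (F R : ℕ → RepSpace d → RepSpace d) (k : ℕ) (x : RepSpace d) : RepSpace d := F k x + R k x

/-- The representation after the first `k` layers, for the network input `x`. -/
def state (F R : ℕ → RepSpace d → RepSpace d) : ℕ → RepSpace d → RepSpace d
  | 0, x => x
  | k + 1, x => layer F R k (state F R k x)

/-- `runFrom F R k n y` applies the layers `k, k + 1, …, k + n - 1`, in this order, to `y`. -/
def runFrom (F R : ℕ → RepSpace d → RepSpace d) : ℕ → ℕ → RepSpace d → RepSpace d
  | _, 0, y => y
  | k, n + 1, y => runFrom F R (k + 1) n (layer F R k y)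

/-- The loss of the `K`-layer network as a function of its `k`-th representation (`k ≤ K`). -/
def lossFrom (F R : ℕ → RepSpace d → RepSpace d) (loss : RepSpace d → ℝ) (K k : ℕ) (y : RepSpace d) : ℝ :=
  loss (runFrom F R k (K - k) y)

/-- The gradient of the loss of the `K`-layer network with respect to its `k`-th representation,
at the representation that the input `x` produces. -/
noncomputable def lossGrad (F R : ℕ → RepSpace d → RepSpace d) (loss : RepSpace d → ℝ) (K k : ℕ) (x : RepSpace d) :
    RepSpace d :=
  gradient (lossFrom F R loss K k) (state F R k x)

end GResNet

/-! The network follows a path of injective maps from the identity to `H`. Fix `x₀` with `A =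
H'(x₀)` bounded by `Λ = max 1 L`, and let `Q` be the positive square root of `(A⁻¹)*A⁻¹`, so that
`‖Q w‖ = ‖A⁻¹ w‖` and `QA` is an isometry. With `C_t = (1-t)Q + t·id`, set `S_t(x) = C_t (t⁻¹(H(x₀ +
t(x - x₀)) - H x₀)) + H x₀`. Then `S_1 = H`, and as `t → 0` the derivative tends to `QA`. Norms do
not see this isometry, so the path may start at the identity instead.

The layers are `S_{(k+1)/K} ∘ S_{k/K}⁻¹`, with `R` subtracted in `F`. Positivity of `Q` keeps `C_t`
well conditioned (`norm_le_mul_norm_interpolation`), hence consecutive derivatives `C_t H'(x₀ + t(x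
- x₀))` differ by a relative error `O(1/K)` (`norm_pathDeriv_sub_le`). Each layer derivative is
therefore a near-isometry, and so is its adjoint, which transports the gradients
(`norm_gradient_comp_bounds`). The `1/K` rate is stronger than `log(2K)/K`. -/

open Set Filter Topology
open scoped RealInnerProductSpace

/-! ### Linear algebra and calculus tools -/

/-- Every operator on a finite-dimensional real inner product space has the same norms as a
positive one. -/
theorem exists_positive_norm_eq {E : Type*} [NormedAddCommGroup E] [InnerProductSpace ℝ E]
    [FiniteDimensional ℝ E] (B : E →L[ℝ] E) :
    ∃ Q : E →L[ℝ] E, (∀ w, 0 ≤ ⟪Q w, w⟫) ∧ ∀ w, ‖Q w‖ = ‖B w‖ := by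
  have hpos : (B.toLinearMap.adjoint ∘ₗ B.toLinearMap).IsPositive :=
    LinearMap.isPositive_adjoint_comp_self _
  set T := B.toLinearMap.adjoint ∘ₗ B.toLinearMap with hT
  have hsym := hpos.isSymmetric
  let b := hsym.eigenvectorBasis rfl
  let μ := hsym.eigenvalues rfl
  have hμ : ∀ i, 0 ≤ μ i := hpos.nonneg_eigenvalues rfl
  -- The positive square root of `B*B`, written in an orthonormal eigenbasis.
  let Q : E →ₗ[ℝ] E := ∑ i, (√(μ i)) • ((innerₛₗ ℝ (b i)).smulRight (b i))
  have hQ : ∀ w, Q w = ∑ i, (√(μ i) * ⟪b i, w⟫) • b i := by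
    intro w
    simp [Q, LinearMap.sum_apply, smul_smul]
  have hQi : ∀ w i, ⟪b i, Q w⟫ = √(μ i) * ⟪b i, w⟫ := by
    intro w i
    rw [hQ, b.orthonormal.inner_right_fintype]
  refine ⟨Q.toContinuousLinearMap, fun w => ?_, fun w => ?_⟩
  · change 0 ≤ ⟪Q w, w⟫
    rw [← b.sum_inner_mul_inner]
    refine Finset.sum_nonneg fun i _ => ?_
    rw [real_inner_comm, hQi, mul_assoc]
    exact mul_nonneg (Real.sqrt_nonneg _) (mul_self_nonneg _)
  · change ‖Q w‖ = ‖B w‖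
    have h : ‖Q w‖ ^ 2 = ‖B w‖ ^ 2 := by
      have h1 : ‖B w‖ ^ 2 = ⟪T w, w⟫ := by
        rw [hT, LinearMap.comp_apply, LinearMap.adjoint_inner_left, real_inner_self_eq_norm_sq]
        rfl
      rw [h1, ← b.sum_sq_norm_inner_right, ← b.sum_inner_mul_inner]
      refine Finset.sum_congr rfl fun i _ => ?_
      have h2 : ⟪T w, b i⟫ = μ i * ⟪b i, w⟫ := by
        rw [hsym w (b i), hsym.apply_eigenvectorBasis rfl i, real_inner_smul_right,
          real_inner_comm]
        rfl
      rw [h2, hQi, Real.norm_eq_abs, sq_abs, mul_pow, Real.sq_sqrt (hμ i)]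
      ring
    exact (sq_eq_sq₀ (norm_nonneg _) (norm_nonneg _)).1 h

/-- Injectivity on the open set `s` forces the global inverse to agree near `f x` with the local
inverse, whose values stay in `s`. Serves to differentiate the layers `S_{k+1} ∘ S_k⁻¹`. -/
theorem hasFDerivAt_comp_invFunOn {E F G : Type*} [NormedAddCommGroup E] [NormedSpace ℝ E]
    [CompleteSpace E] [NormedAddCommGroup F] [NormedSpace ℝ F]
    [NormedAddCommGroup G] [NormedSpace ℝ G] {f : E → F} {g : E → G} {s : Set E} {x : E}
    {f' : E ≃L[ℝ] F} {g' : E →L[ℝ] G} (hs : IsOpen s) (hx : x ∈ s) (hinj : InjOn f s)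
    (hf : HasStrictFDerivAt f (f' : E →L[ℝ] F) x) (hg : HasFDerivAt g g' x) :
    HasFDerivAt (g ∘ Function.invFunOn f s) (g' ∘L (f'.symm : F →L[ℝ] E)) (f x) := by
  have hinv : Function.invFunOn f s (f x) = x := hinj.leftInvOn_invFunOn hx
  have hloc := hf.to_localInverse.hasFDerivAt
  have heq : Function.invFunOn f s =ᶠ[𝓝 (f x)] hf.localInverse f f' x := by
    have h1 : ∀ᶠ y in 𝓝 (f x), hf.localInverse f f' x y ∈ s := by
      apply hf.localInverse_tendsto
      exact hs.mem_nhds hx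
    filter_upwards [h1, hf.eventually_right_inverse] with y hy hy'
    conv_lhs => rw [← hy']
    exact hinj.leftInvOn_invFunOn hy
  have h := hloc.congr_of_eventuallyEq heq
  refine HasFDerivAt.comp (f x) ?_ h
  rwa [hinv]

/-- A lower Lipschitz bound passes to the derivative. -/
theorem norm_le_mul_norm_fderiv_apply {E F : Type*} [NormedAddCommGroup E] [NormedSpace ℝ E]
    [NormedAddCommGroup F] [NormedSpace ℝ F] {f : E → F} {f' : E →L[ℝ] F} {s : Set E} {x : E}
    {β : ℝ} (hs : s ∈ 𝓝 x) (hf : HasFDerivAt f f' x)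
    (hβ : ∀ y ∈ s, ‖y - x‖ ≤ β * ‖f y - f x‖) (v : E) : ‖v‖ ≤ β * ‖f' v‖ := by
  have hline : HasDerivAt (fun r : ℝ => x + r • v) v 0 := by
    simpa using ((hasDerivAt_id (0 : ℝ)).smul_const v).const_add x
  have hcomp : HasDerivAt (fun r : ℝ => f (x + r • v)) (f' v) 0 := by
    have hf0 : HasFDerivAt f f' (x + (0 : ℝ) • v) := by simpa using hf
    exact hf0.comp_hasDerivAt (0 : ℝ) hline
  have hlim := (hcomp.tendsto_slope_zero).norm.const_mul β
  refine ge_of_tendsto hlim ?_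
  have hmem : ∀ᶠ r : ℝ in 𝓝[≠] 0, x + r • v ∈ s := by
    refine (hline.continuousAt.tendsto.mono_left nhdsWithin_le_nhds) ?_
    simpa using hs
  filter_upwards [hmem, self_mem_nhdsWithin] with r hr hr0
  have hr0' : 0 < |r| := abs_pos.2 hr0
  have h := hβ _ hr
  simp only [add_sub_cancel_left, norm_smul, Real.norm_eq_abs] at h
  simp only [zero_add, zero_smul, add_zero, norm_smul, norm_inv, Real.norm_eq_abs]
  rw [mul_left_comm, inv_mul_eq_div, le_div_iff₀ hr0', mul_comm]
  exact h

/-- A relative bound on an open set controls the operator norm. -/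
theorem exists_norm_apply_le_of_isOpen {E F : Type*} [NormedAddCommGroup E] [NormedSpace ℝ E]
    [NormedAddCommGroup F] [NormedSpace ℝ F] {s : Set E} (hs : IsOpen s) (hne : s.Nonempty) :
    ∃ κ : ℝ, 0 ≤ κ ∧ ∀ (T : E →L[ℝ] F) (a : ℝ), 0 ≤ a → (∀ z ∈ s, ‖T z‖ ≤ a * ‖z‖) →
      ∀ v, ‖T v‖ ≤ κ * a * ‖v‖ := by
  obtain ⟨p, hp⟩ := hne
  obtain ⟨ε, hε, hball⟩ := Metric.isOpen_iff.1 hs p hp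
  refine ⟨4 * ‖p‖ / ε + 1, by positivity, fun T a ha hT v => ?_⟩
  rcases eq_or_ne v 0 with rfl | hv
  · simp
  have hv0 : 0 < ‖v‖ := norm_pos_iff.2 hv
  -- Scaled to length `ε / 2`, `v` is a difference of two points of `s`; dividing the resulting
  -- bound by `c` produces `4‖p‖/ε + 1`.
  set c := ε / 2 / ‖v‖ with hc
  have hc0 : 0 < c := by positivity
  have hcv : ‖c • v‖ = ε / 2 := by
    rw [norm_smul, Real.norm_of_nonneg hc0.le, hc, div_mul_cancel₀ _ hv0.ne']
  have hmem : p + c • v ∈ s := hball (by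
    rw [mem_ball_iff_norm, add_sub_cancel_left, hcv]
    linarith)
  have h1 : ‖T (c • v)‖ ≤ a * (2 * ‖p‖ + ε / 2) := by
    have h2 : T (c • v) = T (p + c • v) - T p := by rw [map_add, add_sub_cancel_left]
    rw [h2]
    calc _ ≤ ‖T (p + c • v)‖ + ‖T p‖ := norm_sub_le _ _
      _ ≤ a * ‖p + c • v‖ + a * ‖p‖ := add_le_add (hT _ hmem) (hT p hp)
      _ ≤ a * (‖p‖ + ε / 2) + a * ‖p‖ := by
          gcongr
          exact (norm_add_le _ _).trans_eq (by rw [hcv])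
      _ = _ := by ring
  rw [map_smul, norm_smul, Real.norm_of_nonneg hc0.le] at h1
  refine le_of_mul_le_mul_left (h1.trans_eq ?_) hc0
  rw [hc]
  field_simp
  ring

/-- The cross term is nonnegative, so the square of the combination is at least `(1-t)²‖a‖² +
t²‖w‖²`, and `(1-t)² + t² ≥ 1/4`. -/
theorem norm_le_mul_norm_interpolation {E : Type*} [NormedAddCommGroup E]
    [InnerProductSpace ℝ E] {a w : E} {t Λ : ℝ} (ht0 : 0 ≤ t) (ht1 : t ≤ 1) (hΛ : 1 ≤ Λ)
    (hpos : 0 ≤ ⟪a, w⟫) (ha : ‖w‖ ≤ Λ * ‖a‖) : ‖w‖ ≤ 2 * Λ * ‖(1 - t) • a + t • w‖ := by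
  have h1 : ‖(1 - t) • a + t • w‖ ^ 2 =
      (1 - t) ^ 2 * ‖a‖ ^ 2 + 2 * ((1 - t) * t * ⟪a, w⟫) + t ^ 2 * ‖w‖ ^ 2 := by
    rw [norm_add_sq_real, norm_smul, norm_smul, real_inner_smul_left, real_inner_smul_right,
      mul_pow, mul_pow, Real.norm_eq_abs, Real.norm_eq_abs, sq_abs, sq_abs]
    ring
  have h2 : 0 ≤ (1 - t) * t * ⟪a, w⟫ := mul_nonneg (mul_nonneg (by linarith) ht0) hpos
  have h3 : ‖w‖ ^ 2 ≤ Λ ^ 2 * ‖a‖ ^ 2 := by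
    rw [← mul_pow]; exact pow_le_pow_left₀ (norm_nonneg _) ha 2
  have h4 : ‖w‖ ^ 2 ≤ Λ ^ 2 * ‖w‖ ^ 2 := by
    have : 1 ≤ Λ ^ 2 := by nlinarith
    nlinarith [sq_nonneg ‖w‖]
  have h5 : (1 - t) ^ 2 * ‖w‖ ^ 2 ≤ (1 - t) ^ 2 * (Λ ^ 2 * ‖a‖ ^ 2) := by gcongr
  have h6 : t ^ 2 * ‖w‖ ^ 2 ≤ t ^ 2 * (Λ ^ 2 * ‖w‖ ^ 2) := by gcongr
  have h7 : ‖w‖ ^ 2 ≤ 4 * ((1 - t) ^ 2 * ‖w‖ ^ 2 + t ^ 2 * ‖w‖ ^ 2) := by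
    nlinarith [mul_nonneg (sq_nonneg (2 * t - 1)) (sq_nonneg ‖w‖), sq_nonneg ‖w‖]
  refine le_of_sq_le_sq ?_ (by positivity)
  rw [mul_pow, h1]
  nlinarith [mul_nonneg (sq_nonneg Λ) h2]

/-! ### From a chain of maps to a network -/

namespace GResNet

variable {d : ℕ}

/-- The norms of the gradients before and after a layer whose derivative is a near-isometry. -/
theorem norm_gradient_comp_bounds {E : Type*} [NormedAddCommGroup E] [InnerProductSpace ℝ E]
    [CompleteSpace E] {f : E → ℝ} {g : E → E} {x : E} {T : E ≃L[ℝ] E} {δ : ℝ} (hδ : 0 ≤ δ)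
    (hf : DifferentiableAt ℝ f (g x)) (hg : HasFDerivAt g (T : E →L[ℝ] E) x)
    (hT : ∀ w, (1 - δ) * ‖w‖ ≤ ‖T w‖ ∧ ‖T w‖ ≤ (1 + δ) * ‖w‖) :
    (1 - δ) * ‖gradient f (g x)‖ ≤ ‖gradient (f ∘ g) x‖ ∧
      ‖gradient (f ∘ g) x‖ ≤ (1 + δ) * ‖gradient f (g x)‖ := by
  have hnorm : ∀ (h : E → ℝ) (y : E), ‖gradient h y‖ = ‖fderiv ℝ h y‖ := fun h y =>
    (InnerProductSpace.toDual ℝ E).symm.norm_map _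
  have hcomp : fderiv ℝ (f ∘ g) x = (fderiv ℝ f (g x)) ∘L (T : E →L[ℝ] E) :=
    (hf.hasFDerivAt.comp x hg).fderiv
  rw [hnorm, hnorm, hcomp]
  constructor
  -- For `δ ≥ 1` the lower bound is trivial; otherwise `T⁻¹` has norm at most `1 / (1 - δ)`.
  · rcases le_or_gt 1 δ with h1 | h1
    · exact (mul_nonpos_of_nonpos_of_nonneg (by linarith) (norm_nonneg _)).trans (norm_nonneg _)
    · have h1' : 0 < 1 - δ := by linarith
      rw [mul_comm, ← le_div_iff₀ h1']
      refine ContinuousLinearMap.opNorm_le_bound _ (by positivity) fun w => ?_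
      have h2 := ((fderiv ℝ f (g x)) ∘L (T : E →L[ℝ] E)).le_opNorm (T.symm w)
      simp only [ContinuousLinearMap.comp_apply, ContinuousLinearEquiv.coe_coe,
        ContinuousLinearEquiv.apply_symm_apply] at h2
      have h3 := (hT (T.symm w)).1
      rw [T.apply_symm_apply, mul_comm, ← le_div_iff₀ h1'] at h3
      calc _ ≤ _ := h2
        _ ≤ _ * (‖w‖ / (1 - δ)) := by gcongr
        _ = _ := by ring
  · refine (ContinuousLinearMap.opNorm_comp_le _ _).trans ?_
    rw [mul_comm]
    gcongr
    exact ContinuousLinearMap.opNorm_le_bound _ (by linarith) fun w => (hT w).2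

/-- A chain of local diffeomorphisms, in which consecutive derivatives are nearly isometric, is
realized by a network in which the norm of the gradient is nearly constant. -/
theorem exists_layers_of_chain {s : Set (RepSpace d)} (hs : IsOpen s) {K : ℕ} {δ : ℝ}
    (hδ : 0 ≤ δ) (S : ℕ → RepSpace d → RepSpace d)
    (D : ℕ → RepSpace d → RepSpace d ≃L[ℝ] RepSpace d) (hS0 : ∀ x ∈ s, S 0 x = x)
    (hinj : ∀ k ≤ K, InjOn (S k) s)
    (hD : ∀ k ≤ K, ∀ x ∈ s,
      HasStrictFDerivAt (S k) (D k x : RepSpace d →L[ℝ] RepSpace d) x)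
    (hiso : ∀ k < K, ∀ x ∈ s, ∀ v,
      (1 - δ) * ‖D k x v‖ ≤ ‖D (k + 1) x v‖ ∧ ‖D (k + 1) x v‖ ≤ (1 + δ) * ‖D k x v‖)
    (R : ℕ → RepSpace d → RepSpace d) :
    ∃ F : ℕ → RepSpace d → RepSpace d,
      (∀ x ∈ s, state F R K x = S K x) ∧
      (∀ x ∈ s, ∀ k < K, DifferentiableAt ℝ (layer F R k) (state F R k x)) ∧
      ∀ x ∈ s, ∀ loss : RepSpace d → ℝ, DifferentiableAt ℝ loss (S K x) →
        (∀ k ≤ K, DifferentiableAt ℝ (lossFrom F R loss K k) (state F R k x)) ∧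
        ∀ k : ℕ, 1 ≤ k → k ≤ K →
          (1 - δ) * ‖lossGrad F R loss K k x‖ ≤ ‖lossGrad F R loss K (k - 1) x‖ ∧
          ‖lossGrad F R loss K (k - 1) x‖ ≤ (1 + δ) * ‖lossGrad F R loss K k x‖ := by
  -- Subtracting `R k` leaves the layer equal to `S (k + 1) ∘ (S k)⁻¹`, whatever the residual terms
  -- are.
  let F : ℕ → RepSpace d → RepSpace d := fun k y =>
    S (k + 1) (Function.invFunOn (S k) s y) - R k y
  have hlayer : ∀ k, layer F R k = S (k + 1) ∘ Function.invFunOn (S k) s := fun k =>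
    funext fun y => sub_add_cancel _ _
  have hstate : ∀ x ∈ s, ∀ k ≤ K, state F R k x = S k x := by
    intro x hx k
    induction k with
    | zero => exact fun _ => (hS0 x hx).symm
    | succ k ih =>
      intro hk
      change layer F R k (state F R k x) = _
      rw [ih (by omega), hlayer, Function.comp_apply,
        (hinj k (by omega)).leftInvOn_invFunOn hx]
  let T : ℕ → RepSpace d → RepSpace d ≃L[ℝ] RepSpace d := fun k x =>
    (D k x).symm.trans (D (k + 1) x)
  have hT : ∀ k < K, ∀ x ∈ s, HasFDerivAt (layer F R k)
      (T k x : RepSpace d →L[ℝ] RepSpace d) (state F R k x) := by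
    intro k hk x hx
    rw [hstate x hx k hk.le, hlayer]
    exact hasFDerivAt_comp_invFunOn hs hx (hinj k hk.le) (hD k hk.le x hx)
      (hD (k + 1) hk x hx).hasFDerivAt
  have hTiso : ∀ k < K, ∀ x ∈ s, ∀ w,
      (1 - δ) * ‖w‖ ≤ ‖T k x w‖ ∧ ‖T k x w‖ ≤ (1 + δ) * ‖w‖ := by
    intro k hk x hx w
    have h := hiso k hk x hx ((D k x).symm w)
    rwa [(D k x).apply_symm_apply] at h
  have hloss : ∀ loss : RepSpace d → ℝ, ∀ k < K,
      lossFrom F R loss K k = lossFrom F R loss K (k + 1) ∘ layer F R k := by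
    intro loss k hk
    funext y
    have hn : K - k = (K - (k + 1)) + 1 := by omega
    simp only [lossFrom, Function.comp_apply, hn, runFrom]
  have hdiff : ∀ x ∈ s, ∀ loss : RepSpace d → ℝ, DifferentiableAt ℝ loss (S K x) →
      ∀ k ≤ K, DifferentiableAt ℝ (lossFrom F R loss K k) (state F R k x) := by
    intro x hx loss hl k hk
    induction hk using Nat.decreasingInduction with
    | self =>
      have h : lossFrom F R loss K K = loss := by
        funext y
        simp [lossFrom, runFrom]
      rwa [h, hstate x hx K le_rfl]
    | of_succ k hk ih =>
      rw [hloss loss k hk]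
      exact DifferentiableAt.comp _ ih (hT k hk x hx).differentiableAt
  refine ⟨F, fun x hx => hstate x hx K le_rfl,
    fun x hx k hk => (hT k hk x hx).differentiableAt, fun x hx loss hl =>
      ⟨hdiff x hx loss hl, fun k hk1 hkK => ?_⟩⟩
  obtain ⟨j, rfl⟩ : ∃ j, k = j + 1 := ⟨k - 1, by omega⟩
  have hj : j < K := by omega
  have h := norm_gradient_comp_bounds (g := layer F R j) hδ
    (hdiff x hx loss hl (j + 1) hkK) (hT j hj x hx)
    (hTiso j hj x hx)
  rw [← hloss loss j hj] at h
  exact h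

end GResNet

/-! ### Consequences of the target assumption -/

namespace TargetAssumption

variable {d : ℕ} {𝒳 𝒴 : Set (RepSpace d)} {H : RepSpace d → RepSpace d} {α β : ℝ}

theorem norm_sub_le (h : TargetAssumption 𝒳 𝒴 H α β) {x y : RepSpace d} (hx : x ∈ 𝒳)
    (hy : y ∈ 𝒳) : ‖x - y‖ ≤ β * ‖H x - H y‖ := by
  have h1 := h.lipschitz_inverse _ (h.invertible.mapsTo hx) _ (h.invertible.mapsTo hy)
  rwa [h.invertible.injOn.leftInvOn_invFunOn hx, h.invertible.injOn.leftInvOn_invFunOn hy] at h1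

theorem norm_le_mul_norm_fderiv (h : TargetAssumption 𝒳 𝒴 H α β) (h_open : IsOpen 𝒳)
    {x : RepSpace d} (hx : x ∈ 𝒳) (v : RepSpace d) : ‖v‖ ≤ β * ‖fderiv ℝ H x v‖ :=
  norm_le_mul_norm_fderiv_apply (h_open.mem_nhds hx) (h.differentiable x hx).hasFDerivAt
    (fun _ hy => h.norm_sub_le hy hx) v

theorem hasStrictFDerivAt (h : TargetAssumption 𝒳 𝒴 H α β) (h_open : IsOpen 𝒳)
    {x : RepSpace d} (hx : x ∈ 𝒳) : HasStrictFDerivAt H (fderiv ℝ H x) x := by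
  refine hasStrictFDerivAt_of_hasFDerivAt_of_continuousAt (f' := fderiv ℝ H) ?_ ?_
  · filter_upwards [h_open.mem_nhds hx] with y hy using (h.differentiable y hy).hasFDerivAt
  -- The smoothness bound is given only for `z ∈ 𝒳`; `κ` extends it to all vectors, so `H'` is
  -- Lipschitz in operator norm.
  · obtain ⟨κ, hκ0, hκ⟩ := exists_norm_apply_le_of_isOpen (F := RepSpace d) h_open ⟨x, hx⟩
    have hlip : LipschitzOnWith (NNReal.mk (κ * α) (mul_nonneg hκ0 h.alpha_pos.le)) (fderiv ℝ H) 𝒳 := by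
      refine LipschitzOnWith.of_dist_le_mul fun y hy z hz => ?_
      rw [dist_eq_norm, dist_eq_norm]
      exact ContinuousLinearMap.opNorm_le_bound _
        (mul_nonneg (mul_nonneg hκ0 h.alpha_pos.le) (norm_nonneg _)) fun v =>
          (hκ _ _ (mul_nonneg h.alpha_pos.le (norm_nonneg _)) (h.smooth y hy z hz) v).trans_eq
            (by rw [NNReal.coe_mk]; ring)
    exact hlip.continuousOn.continuousAt (h_open.mem_nhds hx)

end TargetAssumption

/-! ### The path from the identity to `H` -/

namespace GResNet

variable {d : ℕ}

/-- The path of operators from `Q` to the identity. -/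
noncomputable def interpolation (Q : RepSpace d →L[ℝ] RepSpace d) (t : ℝ) :
    RepSpace d →L[ℝ] RepSpace d :=
  (1 - t) • Q + t • ContinuousLinearMap.id ℝ (RepSpace d)

theorem interpolation_apply (Q : RepSpace d →L[ℝ] RepSpace d) (t : ℝ) (w : RepSpace d) :
    interpolation Q t w = (1 - t) • Q w + t • w := rfl

/-- The derivative along the path `t ↦ interpolation Q t ∘ (t⁻¹ • (H (x₀ + t • (· - x₀)) - H x₀))`
of maps. -/
noncomputable def pathDeriv (H : RepSpace d → RepSpace d) (Q : RepSpace d →L[ℝ] RepSpace d)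
    (x₀ : RepSpace d) (t : ℝ) (x : RepSpace d) : RepSpace d →L[ℝ] RepSpace d :=
  interpolation Q t ∘L fderiv ℝ H (x₀ + t • (x - x₀))

/-- Two changes contribute: that of the interpolated operator and that of the base point of `H'`.
Both are bounded by multiples of `‖w‖`, `w = H'(z) v`, and conditioning of `C_t` turns `‖w‖` into
the norm of the path derivative. -/
theorem norm_pathDeriv_sub_le {𝒳 𝒴 : Set (RepSpace d)} {H : RepSpace d → RepSpace d}
    {α β κ Λ r : ℝ} (h : TargetAssumption 𝒳 𝒴 H α β) (h_open : IsOpen 𝒳)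
    {Q : RepSpace d →L[ℝ] RepSpace d} {x₀ : RepSpace d} (hκ0 : 0 ≤ κ)
    (hκ : ∀ (T : RepSpace d →L[ℝ] RepSpace d) (a : ℝ), 0 ≤ a →
      (∀ z ∈ 𝒳, ‖T z‖ ≤ a * ‖z‖) → ∀ v, ‖T v‖ ≤ κ * a * ‖v‖)
    (hr : ∀ x ∈ 𝒳, ‖x - x₀‖ ≤ r)
    (hz : ∀ x ∈ 𝒳, ∀ t : ℝ, 0 ≤ t → t ≤ 1 → x₀ + t • (x - x₀) ∈ 𝒳)
    (hQ : ∀ w, ‖Q w‖ ≤ β * ‖w‖)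
    (hC : ∀ t : ℝ, 0 ≤ t → t ≤ 1 → ∀ w, ‖w‖ ≤ 2 * Λ * ‖interpolation Q t w‖)
    {x : RepSpace d} (hx : x ∈ 𝒳) {t t' : ℝ} (ht0 : 0 ≤ t) (ht1 : t ≤ 1) (ht0' : 0 ≤ t')
    (ht1' : t' ≤ 1) (v : RepSpace d) :
    ‖pathDeriv H Q x₀ t' x v - pathDeriv H Q x₀ t x v‖ ≤
      |t' - t| * (2 * Λ * ((1 + β) * (1 + α * β * (κ * r)))) * ‖pathDeriv H Q x₀ t x v‖ := by
  have hα := h.alpha_pos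
  have hβ := h.beta_pos
  have hr0 : 0 ≤ r := (norm_nonneg _).trans (hr x hx)
  set z := x₀ + t • (x - x₀) with hzdef
  set z' := x₀ + t' • (x - x₀) with hzdef'
  have hzx : z ∈ 𝒳 := hz x hx t ht0 ht1
  have hzx' : z' ∈ 𝒳 := hz x hx t' ht0' ht1'
  set w := fderiv ℝ H z v with hw
  have hsplit : pathDeriv H Q x₀ t' x v - pathDeriv H Q x₀ t x v =
      (t' - t) • (w - Q w) + interpolation Q t' ((fderiv ℝ H z' - fderiv ℝ H z) v) := by
    simp only [pathDeriv, ContinuousLinearMap.comp_apply, sub_apply,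
      map_sub, ← hzdef, ← hzdef', ← hw]
    rw [interpolation_apply Q t w, interpolation_apply Q t' w]
    module
  have h1 : ‖(t' - t) • (w - Q w)‖ ≤ |t' - t| * ((1 + β) * ‖w‖) := by
    rw [norm_smul, Real.norm_eq_abs]
    gcongr
    linarith [norm_sub_le w (Q w), hQ w]
  have hCle : ∀ u, ‖interpolation Q t' u‖ ≤ (1 + β) * ‖u‖ := by
    intro u
    rw [interpolation_apply]
    refine (norm_add_le _ _).trans ?_
    rw [norm_smul, norm_smul, Real.norm_of_nonneg ht0',
      Real.norm_of_nonneg (sub_nonneg.2 ht1')]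
    have h1 : (1 - t') * ‖Q u‖ ≤ 1 * (β * ‖u‖) :=
      mul_le_mul (by linarith) (hQ u) (norm_nonneg _) zero_le_one
    have h2 : t' * ‖u‖ ≤ 1 * ‖u‖ := mul_le_mul_of_nonneg_right ht1' (norm_nonneg _)
    linarith
  have hzz : ‖z' - z‖ ≤ |t' - t| * r := by
    have : z' - z = (t' - t) • (x - x₀) := by rw [hzdef, hzdef']; module
    rw [this, norm_smul, Real.norm_eq_abs]
    gcongr
    exact hr x hx
  have hv : ‖v‖ ≤ β * ‖w‖ := h.norm_le_mul_norm_fderiv h_open hzx v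
  have h2 : ‖interpolation Q t' ((fderiv ℝ H z' - fderiv ℝ H z) v)‖ ≤
      (1 + β) * (κ * (α * (|t' - t| * r)) * (β * ‖w‖)) := by
    refine (hCle _).trans ?_
    gcongr
    refine (hκ _ _ (by positivity) (h.smooth z' hzx' z hzx) v).trans ?_
    gcongr
  have h3 : ‖w‖ ≤ 2 * Λ * ‖pathDeriv H Q x₀ t x v‖ := hC t ht0 ht1 w
  calc ‖pathDeriv H Q x₀ t' x v - pathDeriv H Q x₀ t x v‖
      ≤ |t' - t| * ((1 + β) * ‖w‖) + (1 + β) * (κ * (α * (|t' - t| * r)) * (β * ‖w‖)) := by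
        rw [hsplit]
        exact (norm_add_le _ _).trans (add_le_add h1 h2)
    _ = |t' - t| * ((1 + β) * (1 + α * β * (κ * r))) * ‖w‖ := by ring
    _ ≤ |t' - t| * ((1 + β) * (1 + α * β * (κ * r))) * (2 * Λ * ‖pathDeriv H Q x₀ t x v‖) := by
        gcongr
    _ = _ := by ring

/-- The chain of maps from the identity to `H` through the dilations of `H`. -/
noncomputable def pathMap (H : RepSpace d → RepSpace d) (Q : RepSpace d →L[ℝ] RepSpace d)
    (x₀ : RepSpace d) (K k : ℕ) (x : RepSpace d) : RepSpace d :=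
  -- The formula degenerates at `t = 0`; the identity replaces its limit, whose linear part is the
  -- isometry `Q H'(x₀)`.
  if k = 0 then x else
    interpolation Q (k / K) ((k / K : ℝ)⁻¹ • (H (x₀ + (k / K : ℝ) • (x - x₀)) - H x₀)) + H x₀

theorem exists_layers_of_pathDeriv {𝒳 𝒴 : Set (RepSpace d)} {H : RepSpace d → RepSpace d}
    {α β δ : ℝ} (h : TargetAssumption 𝒳 𝒴 H α β) (h_open : IsOpen 𝒳)
    {Q : RepSpace d →L[ℝ] RepSpace d} {x₀ : RepSpace d} (hδ : 0 ≤ δ)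
    (hz : ∀ x ∈ 𝒳, ∀ t : ℝ, 0 ≤ t → t ≤ 1 → x₀ + t • (x - x₀) ∈ 𝒳)
    (hQ : ∀ v, ‖Q (fderiv ℝ H x₀ v)‖ = ‖v‖)
    (hC : ∀ t : ℝ, 0 ≤ t → t ≤ 1 → Function.Injective (interpolation Q t))
    {K : ℕ} (hK : 1 ≤ K)
    (hpath : ∀ k < K, ∀ x ∈ 𝒳, ∀ v,
      ‖pathDeriv H Q x₀ ((k + 1 : ℕ) / K) x v - pathDeriv H Q x₀ (k / K) x v‖ ≤
        δ * ‖pathDeriv H Q x₀ (k / K) x v‖)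
    (R : ℕ → RepSpace d → RepSpace d) :
    ∃ F : ℕ → RepSpace d → RepSpace d,
      (∀ x ∈ 𝒳, state F R K x = H x) ∧
      (∀ x ∈ 𝒳, ∀ k < K, DifferentiableAt ℝ (layer F R k) (state F R k x)) ∧
      ∀ x ∈ 𝒳, ∀ loss : RepSpace d → ℝ, DifferentiableAt ℝ loss (H x) →
        (∀ k ≤ K, DifferentiableAt ℝ (lossFrom F R loss K k) (state F R k x)) ∧
        ∀ k : ℕ, 1 ≤ k → k ≤ K →
          (1 - δ) * ‖lossGrad F R loss K k x‖ ≤ ‖lossGrad F R loss K (k - 1) x‖ ∧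
          ‖lossGrad F R loss K (k - 1) x‖ ≤ (1 + δ) * ‖lossGrad F R loss K k x‖ := by
  have hK0 : (0 : ℝ) < K := by exact_mod_cast hK
  have ht0 : ∀ k : ℕ, (0 : ℝ) ≤ k / K := fun k => by positivity
  have htpos : ∀ k : ℕ, k ≠ 0 → (0 : ℝ) < k / K := fun k hk =>
    div_pos (by exact_mod_cast Nat.pos_of_ne_zero hk) hK0
  have ht1 : ∀ k ≤ K, (k / K : ℝ) ≤ 1 := fun k hk => by
    rw [div_le_one hK0]; exact_mod_cast hk
  have hex : ∀ (k : ℕ) (x : RepSpace d), ∃ e : RepSpace d ≃L[ℝ] RepSpace d,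
      (k = 0 → e = ContinuousLinearEquiv.refl ℝ _) ∧ (k ≠ 0 → k ≤ K → x ∈ 𝒳 →
        (e : RepSpace d →L[ℝ] RepSpace d) = pathDeriv H Q x₀ (k / K) x) := by
    intro k x
    by_cases hk : k ≠ 0 ∧ k ≤ K ∧ x ∈ 𝒳
    · obtain ⟨hk0, hkK, hx⟩ := hk
      have hinj : Function.Injective (pathDeriv H Q x₀ (k / K) x) := by
        refine (hC _ (ht0 k) (ht1 k hkK)).comp ?_
        refine (injective_iff_map_eq_zero _).2 fun v hv => ?_
        have := h.norm_le_mul_norm_fderiv h_open (hz x hx _ (ht0 k) (ht1 k hkK)) v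
        rw [show fderiv ℝ H _ v = 0 from hv, norm_zero, mul_zero] at this
        exact norm_le_zero_iff.1 this
      refine ⟨(LinearEquiv.ofInjectiveEndo
        (pathDeriv H Q x₀ (k / K) x).toLinearMap hinj).toContinuousLinearEquiv,
        fun h0 => absurd h0 hk0, fun _ _ _ => ?_⟩
      ext1 v
      rfl
    · exact ⟨ContinuousLinearEquiv.refl ℝ _, fun _ => rfl,
        fun h1 h2 h3 => absurd ⟨h1, h2, h3⟩ hk⟩
  choose D hD0 hD using hex
  have hDapply : ∀ k : ℕ, k ≠ 0 → k ≤ K → ∀ x ∈ 𝒳, ∀ v,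
      D k x v = pathDeriv H Q x₀ (k / K) x v := fun k hk0 hkK x hx v =>
    DFunLike.congr_fun (hD k x hk0 hkK hx) v
  -- At `k = 0` the two operators may differ, but only by an isometry, so their norms agree; the
  -- chain needs norms only.
  have hDnorm : ∀ k ≤ K, ∀ x ∈ 𝒳, ∀ v, ‖D k x v‖ = ‖pathDeriv H Q x₀ (k / K) x v‖ := by
    intro k hkK x hx v
    rcases eq_or_ne k 0 with rfl | hk0
    · rw [hD0 0 x rfl]
      simp [pathDeriv, interpolation_apply, hQ]
    · rw [hDapply k hk0 hkK x hx]
  have hmain := exists_layers_of_chain h_open (K := K) hδ (pathMap H Q x₀ K) D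
    (fun x _ => if_pos rfl) ?_ ?_ ?_ R
  · have hend : ∀ x, pathMap H Q x₀ K K x = H x := by
      intro x
      have hK' : K ≠ 0 := by omega
      simp [pathMap, hK', hK0.ne', interpolation_apply]
    simpa only [hend] using hmain
  · intro k hkK x hx y hy hxy
    rcases eq_or_ne k 0 with rfl | hk0
    · simpa [pathMap] using hxy
    · simp only [pathMap, if_neg hk0] at hxy
      have h1 := hC _ (ht0 k) (ht1 k hkK) (add_right_cancel hxy)
      have h2 := sub_left_injective (smul_right_injective _ (inv_ne_zero (htpos k hk0).ne') h1)
      have h3 := h.invertible.injOn (hz x hx _ (ht0 k) (ht1 k hkK))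
        (hz y hy _ (ht0 k) (ht1 k hkK)) h2
      exact sub_left_injective (smul_right_injective _ (htpos k hk0).ne' (add_left_cancel h3))
  · intro k hkK x hx
    rcases eq_or_ne k 0 with rfl | hk0
    · rw [hD0 0 x rfl]
      have : pathMap H Q x₀ K 0 = id := funext fun x => if_pos rfl
      rw [this]
      exact hasStrictFDerivAt_id x
    · have hmap : pathMap H Q x₀ K k = fun x => interpolation Q (k / K)
          ((k / K : ℝ)⁻¹ • (H (x₀ + (k / K : ℝ) • (x - x₀)) - H x₀)) + H x₀ :=
        funext fun x => if_neg hk0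
      have hline : HasStrictFDerivAt (fun x : RepSpace d => x₀ + (k / K : ℝ) • (x - x₀))
          ((k / K : ℝ) • ContinuousLinearMap.id ℝ (RepSpace d)) x :=
        (((hasStrictFDerivAt_id x).sub_const x₀).const_smul (k / K : ℝ)).const_add x₀
      have hcomp := (h.hasStrictFDerivAt h_open (hz x hx _ (ht0 k) (ht1 k hkK))).comp x hline
      have hall := (((interpolation Q (k / K : ℝ)).hasStrictFDerivAt).comp x
        ((hcomp.sub_const (H x₀)).const_smul (k / K : ℝ)⁻¹)).add_const (H x₀)
      rw [hmap, hD k x hk0 hkK hx]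
      refine hall.congr_fderiv ?_
      ext1 v
      have hcancel : (K / k * (k / K) : ℝ) = 1 := by
        have : (k : ℝ) ≠ 0 := by exact_mod_cast hk0
        field_simp
      simp [pathDeriv, smul_smul, hcancel]
  · intro k hkK x hx v
    have h1 := hpath k hkK x hx v
    rw [hDnorm k hkK.le x hx, hDnorm (k + 1) hkK x hx]
    have h2 := norm_sub_norm_le (pathDeriv H Q x₀ ((k + 1 : ℕ) / K) x v)
      (pathDeriv H Q x₀ (k / K) x v)
    have h3 := norm_sub_norm_le (pathDeriv H Q x₀ (k / K) x v)
      (pathDeriv H Q x₀ ((k + 1 : ℕ) / K) x v)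
    rw [norm_sub_rev] at h3
    constructor <;> linarith

/-- A left inverse `Q` of `H'(x₀)` up to an isometry, for which the whole path from `Q` to the
identity is well conditioned. -/
theorem exists_positive_left_inverse {𝒳 𝒴 : Set (RepSpace d)} {H : RepSpace d → RepSpace d}
    {α β Λ : ℝ} (h : TargetAssumption 𝒳 𝒴 H α β) (h_open : IsOpen 𝒳) {x₀ : RepSpace d}
    (hx₀ : x₀ ∈ 𝒳) (hΛ : 1 ≤ Λ) (hL : ‖fderiv ℝ H x₀‖ ≤ Λ) :
    ∃ Q : RepSpace d →L[ℝ] RepSpace d, (∀ v, ‖Q (fderiv ℝ H x₀ v)‖ = ‖v‖) ∧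
      (∀ w, ‖Q w‖ ≤ β * ‖w‖) ∧
      ∀ t : ℝ, 0 ≤ t → t ≤ 1 → ∀ w, ‖w‖ ≤ 2 * Λ * ‖interpolation Q t w‖ := by
  have hlow := h.norm_le_mul_norm_fderiv h_open hx₀
  have hinj : Function.Injective (fderiv ℝ H x₀).toLinearMap := by
    refine (injective_iff_map_eq_zero _).2 fun v hv => ?_
    have h1 := hlow v
    rw [show fderiv ℝ H x₀ v = 0 from hv, norm_zero, mul_zero] at h1
    exact norm_le_zero_iff.1 h1
  let A : RepSpace d ≃L[ℝ] RepSpace d :=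
    (LinearEquiv.ofInjectiveEndo _ hinj).toContinuousLinearEquiv
  have hA : ∀ v, A v = fderiv ℝ H x₀ v := fun v => rfl
  -- Applied to `A⁻¹`: its bound `β` passes to `Q`, and `‖A‖ ≤ Λ` gives `‖w‖ ≤ Λ‖Q w‖`.
  obtain ⟨Q, hpos, hnorm⟩ := exists_positive_norm_eq (A.symm : RepSpace d →L[ℝ] RepSpace d)
  have hnorm' : ∀ w, ‖Q w‖ = ‖A.symm w‖ := hnorm
  refine ⟨Q, fun v => ?_, fun w => ?_, fun t ht0 ht1 w => ?_⟩
  · rw [hnorm', ← hA, A.symm_apply_apply]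
  · rw [hnorm']
    simpa only [← hA, A.apply_symm_apply] using hlow (A.symm w)
  · refine norm_le_mul_norm_interpolation ht0 ht1 hΛ (hpos w) ?_
    change ‖w‖ ≤ Λ * ‖Q w‖
    rw [hnorm']
    have h1 := (fderiv ℝ H x₀).le_of_opNorm_le hL (A.symm w)
    rwa [← hA, A.apply_symm_apply] at h1

end GResNet

/-! ### The rate and the conclusion -/

/-- The near-isometry constant of one step of the path is within the allowed rate. -/
theorem path_rate_le {α β Λ r : ℝ} (hα : 0 < α) (hβ : 0 < β) (hr : 0 ≤ r) (hΛ : 1 ≤ Λ)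
    (hΛβ : 1 ≤ Λ * β) {K : ℕ} (hK : 1 ≤ K) :
    1 / (K : ℝ) * (2 * Λ * ((1 + β) * (1 + α * β * r))) ≤
      4 * Λ * (1 + Λ + r) * max (α * β * (1 + β)) (β * (2 + α) + α) *
        (Real.log (2 * K) / K) := by
  have hK1 : (1 : ℝ) ≤ K := by exact_mod_cast hK
  set M := max (α * β * (1 + β)) (β * (2 + α) + α)
  have hM1 : α * β * (1 + β) ≤ M := le_max_left _ _
  have hM2 : β ≤ M := by
    refine le_trans ?_ (le_max_right _ _)
    nlinarith [mul_pos hα hβ]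
  have hlog : 1 / 2 ≤ Real.log (2 * K) := by
    have h1 : Real.log 2 ≤ Real.log (2 * K) := Real.log_le_log (by norm_num) (by linarith)
    linarith [Real.log_two_gt_d9]
  have h1 : (1 + β) * (1 + α * β * r) ≤ (1 + Λ + r) * M := by
    -- Here `1 ≤ Λβ ≤ ΛM` absorbs the constant term.
    have h2 : 1 + β ≤ (1 + Λ) * M := by nlinarith
    have h3 : α * β * (1 + β) * r ≤ M * r := by gcongr
    nlinarith
  have hM0 : 0 ≤ M := hβ.le.trans hM2
  calc 1 / (K : ℝ) * (2 * Λ * ((1 + β) * (1 + α * β * r)))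
      ≤ 1 / (K : ℝ) * (2 * Λ * ((1 + Λ + r) * M)) := by gcongr
    _ = 4 * Λ * (1 + Λ + r) * M * ((1 / 2) / K) := by ring
    _ ≤ _ := by gcongr

theorem theorem3 (d : ℕ) (𝒳 : Set (RepSpace d)) (h_open : IsOpen 𝒳) (h_convex : Convex ℝ 𝒳)
    (h_bounded : Bornology.IsBounded 𝒳) (L : ℝ) :
    ∃ c₁ : ℝ, 0 < c₁ ∧
      ∀ (𝒴 : Set (RepSpace d)) (H : RepSpace d → RepSpace d) (α β : ℝ),
        TargetAssumption 𝒳 𝒴 H α β →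
        (∃ x ∈ 𝒳, ‖fderiv ℝ H x‖ ≤ L) →
        ∀ K : ℕ, 1 ≤ K → ∀ R : ℕ → RepSpace d → RepSpace d,
          ∃ F : ℕ → RepSpace d → RepSpace d,
            (∀ x ∈ 𝒳, GResNet.state F R K x = H x) ∧
            (∀ x ∈ 𝒳, ∀ k < K,
              DifferentiableAt ℝ (GResNet.layer F R k) (GResNet.state F R k x)) ∧
            ∃ δ : ℝ, 0 ≤ δ ∧
              δ ≤ c₁ * max (α * β * (1 + β)) (β * (2 + α) + α) * (Real.log (2 * K) / K) ∧
              ∀ x ∈ 𝒳, ∀ loss : RepSpace d → ℝ, DifferentiableAt ℝ loss (H x) →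
                (∀ k ≤ K, DifferentiableAt ℝ (GResNet.lossFrom F R loss K k)
                  (GResNet.state F R k x)) ∧
                ∀ k : ℕ, 1 ≤ k → k ≤ K →
                  (1 - δ) * ‖GResNet.lossGrad F R loss K k x‖
                      ≤ ‖GResNet.lossGrad F R loss K (k - 1) x‖ ∧
                  ‖GResNet.lossGrad F R loss K (k - 1) x‖
                      ≤ (1 + δ) * ‖GResNet.lossGrad F R loss K k x‖ := by
  set Λ := max 1 L
  have hΛ : 1 ≤ Λ := le_max_left _ _
  set r := Metric.diam 𝒳
  have hr0 : 0 ≤ r := Metric.diam_nonneg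
  rcases 𝒳.eq_empty_or_nonempty with rfl | hne
  · exact ⟨1, one_pos, fun _ _ _ _ _ ⟨x, hx, _⟩ => absurd hx (notMem_empty x)⟩
  obtain ⟨κ, hκ0, hκ⟩ := exists_norm_apply_le_of_isOpen (F := RepSpace d) h_open hne
  refine ⟨4 * Λ * (1 + Λ + κ * r), by positivity, ?_⟩
  rintro 𝒴 H α β h ⟨x₀, hx₀, hL⟩ K hK R
  have hα := h.alpha_pos
  have hβ := h.beta_pos
  have hK0 : (0 : ℝ) < K := by exact_mod_cast hK
  have hΛx : ‖fderiv ℝ H x₀‖ ≤ Λ := hL.trans (le_max_right _ _)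
  have hr : ∀ x ∈ 𝒳, ‖x - x₀‖ ≤ r := fun x hx => by
    rw [← dist_eq_norm]
    exact Metric.dist_le_diam_of_mem h_bounded hx hx₀
  have hz : ∀ x ∈ 𝒳, ∀ t : ℝ, 0 ≤ t → t ≤ 1 → x₀ + t • (x - x₀) ∈ 𝒳 :=
    fun x hx t ht0 ht1 => h_convex.add_smul_sub_mem hx₀ hx ⟨ht0, ht1⟩
  obtain ⟨Q, hQA, hQ, hC⟩ := GResNet.exists_positive_left_inverse h h_open hx₀ hΛ hΛx
  have hCinj : ∀ t : ℝ, 0 ≤ t → t ≤ 1 → Function.Injective (GResNet.interpolation Q t) := by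
    intro t ht0 ht1
    refine (injective_iff_map_eq_zero _).2 fun w hw => ?_
    have h1 := hC t ht0 ht1 w
    rw [hw, norm_zero, mul_zero] at h1
    exact norm_le_zero_iff.1 h1
  suffices hδ : ∃ δ : ℝ, 0 ≤ δ ∧
      δ ≤ 4 * Λ * (1 + Λ + κ * r) * max (α * β * (1 + β)) (β * (2 + α) + α) *
        (Real.log (2 * K) / K) ∧
      ∀ k < K, ∀ x ∈ 𝒳, ∀ v,
        ‖GResNet.pathDeriv H Q x₀ ((k + 1 : ℕ) / K) x v - GResNet.pathDeriv H Q x₀ (k / K) x v‖ ≤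
          δ * ‖GResNet.pathDeriv H Q x₀ (k / K) x v‖ by
    obtain ⟨δ, hδ0, hδle, hpath⟩ := hδ
    obtain ⟨F, hF1, hF2, hF3⟩ :=
      GResNet.exists_layers_of_pathDeriv h h_open hδ0 hz hQA hCinj hK hpath R
    exact ⟨F, hF1, hF2, δ, hδ0, hδle, hF3⟩
  rcases subsingleton_or_nontrivial (RepSpace d) with hd | hd
  -- In dimension zero `1 ≤ Λβ` may fail, but all vectors vanish and `δ = 0` works.
  · refine ⟨0, le_rfl, ?_, fun k _ x _ v => ?_⟩
    · have hlog : 0 ≤ Real.log (2 * K) := Real.log_nonneg (by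
        have : (1 : ℝ) ≤ K := by exact_mod_cast hK
        linarith)
      have hM : 0 ≤ max (α * β * (1 + β)) (β * (2 + α) + α) :=
        le_max_of_le_left (by positivity)
      positivity
    · rw [Subsingleton.elim (_ - _) (0 : RepSpace d), norm_zero, zero_mul]
  · have hΛβ : 1 ≤ Λ * β := by
      obtain ⟨v, hv⟩ := exists_ne (0 : RepSpace d)
      have hv0 : 0 < ‖v‖ := norm_pos_iff.2 hv
      have h1 := h.norm_le_mul_norm_fderiv h_open hx₀ v
      have h2 : ‖fderiv ℝ H x₀ v‖ ≤ Λ * ‖v‖ := (fderiv ℝ H x₀).le_of_opNorm_le hΛx v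
      have h3 : 1 * ‖v‖ ≤ Λ * β * ‖v‖ := by
        calc 1 * ‖v‖ ≤ β * ‖fderiv ℝ H x₀ v‖ := by rwa [one_mul]
          _ ≤ β * (Λ * ‖v‖) := by gcongr
          _ = Λ * β * ‖v‖ := by ring
      exact le_of_mul_le_mul_right h3 hv0
    refine ⟨1 / (K : ℝ) * (2 * Λ * ((1 + β) * (1 + α * β * (κ * r)))), by positivity,
      path_rate_le hα hβ (mul_nonneg hκ0 hr0) hΛ hΛβ hK, fun k hk x hx v => ?_⟩
    have hstep : |((k + 1 : ℕ) : ℝ) / K - k / K| = 1 / K := by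
      rw [← sub_div, Nat.cast_add_one, add_sub_cancel_left, abs_of_pos (by positivity)]
    rw [← hstep]
    refine GResNet.norm_pathDeriv_sub_le h h_open hκ0 hκ hr hz hQ hC hx
      (by positivity) ?_ (by positivity) ?_ v
    · rw [div_le_one hK0]
      exact_mod_cast hk.le
    · rw [div_le_one hK0]
      exact_mod_cast hk
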